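/- Let $S=\mathbb{C}[x_1,x_2,x_3,x_4]$. For $m\ge 1$ let $p_m=x_1^m+x_2^m+x_3^m+x_4^m\in S$ be the power sum of degree $m$, and let $e_4=x_1x_2x_3x_4$. Let $n\ge 1$ be an integer. If $n=4k$ for an integer $k$, then $$p_n\equiv (-1)^k\,4\,e_4^k \pmod{(p_1,p_2,p_3)},$$ and if $4\nmid n$, then $p_n\equiv 0 \pmod{(p_1,p_2,p_3)}$. Moreover, $p_1,p_2,p_3,p_n$ is a regular sequence on $S$ if and only if $4$ divides $n$. Here $f_1,\dots,f_r\in S$ is a regular sequence on $S$ if the ideal $(f_1,\dots,f_r)$ is proper and, for each $0\le i<r$, the image of $f_{i+1}$ is a nonzerodivisor in $S/(f_1,\dots,f_i)$. -/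

import Mathlib

/-!
Write `I = (p₁, p₂, p₃)`. Since `6` is invertible, Newton's identities put `e₁, e₂, e₃` into `I`, so
each variable satisfies `xᵢ⁴ = -e₄` modulo `I` (`six_mul_X_pow_four_add_esymm`). Hence, modulo `I`,
`p_{4q+r} = (-e₄)^q p_r`, which is `4 (-e₄)^q` for `r = 0` and lies in `I` for `r = 1, 2, 3`.

If `4 ∤ n`, then `pₙ` vanishes in `S/I`, and `S/I ≠ 0` as all power sums of positive degree lack a
constant term; so `pₙ` is a zero divisor there.

If `4 ∣ n`, the sequence `p₁, p₂, p₃, pₙ` is compared with the triangular sequence formed by the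
complete homogeneous polynomials `h₁(x₀,x₁,x₂,x₃)`, `h₂(x₁,x₂,x₃)`, `h₃(x₂,x₃)` and by `x₃ⁿ`: every
power sum is a nonzero scalar multiple of the corresponding term modulo the earlier terms, so one
sequence is weakly regular iff the other is (`weaklyRegular_congr_concat`). Each term of the
triangular sequence is monic in a variable that the later terms do not involve. If `f ∈ R[X]` is
monic, it is a nonzerodivisor and `R[X]/(f)` is free over `R`, so `f` followed by a weakly regular
sequence of `R` is weakly regular (`isWeaklyRegular_cons_of_monic`). Four applications of this show
that the triangular sequence is weakly regular.
-/

open MvPolynomial RingTheory.Sequence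

/-! ### Weakly regular sequences -/

open scoped Pointwise in
/-- Flatness of `R[X]/(f)` over `R` carries the regularity of `rs` over to that quotient. -/
theorem isWeaklyRegular_cons_of_monic {R : Type*} [CommRing R] {f : Polynomial R} (hf : f.Monic)
    {rs : List R} (hrs : IsWeaklyRegular R rs) :
    IsWeaklyRegular (Polynomial R) (f :: rs.map Polynomial.C) := by
  rw [isWeaklyRegular_cons_iff]
  refine ⟨fun a b h => hf.isRegular.left h, ?_⟩
  let A := Polynomial R ⧸ Ideal.span {f}
  have : Module.Free R A := hf.free_quotient
  have h1 : IsWeaklyRegular A (rs.map (algebraMap R A)) := hrs.of_flat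
  have h2 : rs.map (algebraMap R A) =
      (rs.map Polynomial.C).map (algebraMap (Polynomial R) A) := by
    rw [List.map_map]; rfl
  rw [h2, isWeaklyRegular_map_algebraMap_iff] at h1
  have h3 : (f • ⊤ : Submodule (Polynomial R) (Polynomial R)) = Ideal.span {f} := by
    rw [← Submodule.ideal_span_singleton_smul, smul_eq_mul, Ideal.mul_top]
  exact ((Submodule.quotEquivOfEq _ _ h3).isWeaklyRegular_congr _).mpr h1

/-- The multivariate form of `isWeaklyRegular_cons_of_monic`, with `X 0` as the main variable. -/
theorem MvPolynomial.isWeaklyRegular_cons_of_monic {R : Type*} [CommRing R] {m : ℕ}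
    {f : MvPolynomial (Fin (m + 1)) R} (hf : (finSuccEquiv R m f).Monic)
    {rs : List (MvPolynomial (Fin m) R)} (hrs : IsWeaklyRegular (MvPolynomial (Fin m) R) rs) :
    IsWeaklyRegular (MvPolynomial (Fin (m + 1)) R) (f :: rs.map (rename Fin.succ)) := by
  refine (AddEquiv.isWeaklyRegular_congr (e := (finSuccEquiv R m).toRingEquiv.toAddEquiv)
    (bs := finSuccEquiv R m f :: rs.map Polynomial.C) ?_).mpr
    (_root_.isWeaklyRegular_cons_of_monic hf hrs)
  refine List.Forall₂.cons (fun x => by simp) ?_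
  rw [List.forall₂_map_left_iff, List.forall₂_map_right_iff, List.forall₂_same]
  intro r hr x
  clear hr
  have h : finSuccEquiv R m (rename Fin.succ r) = Polynomial.C r := by
    induction r using MvPolynomial.induction_on with
    | C a => simp [finSuccEquiv_apply]
    | add p q hp hq => simp only [map_add, hp, hq]
    | mul_X p i hp => simp only [map_mul, hp, rename_X, finSuccEquiv_X_succ]
  simp [h]

theorem isWeaklyRegular_concat_iff {R : Type*} [CommRing R] (rs : List R) (r : R) :
    IsWeaklyRegular R (rs ++ [r]) ↔
      IsWeaklyRegular R rs ∧ ∀ x, r * x ∈ Ideal.ofList rs → x ∈ Ideal.ofList rs := by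
  rw [isWeaklyRegular_append_iff, isWeaklyRegular_singleton_iff,
    isSMulRegular_quotient_iff_mem_of_smul_mem]
  simp only [smul_eq_mul, Ideal.mul_top]

/-- Changing the last term of a sequence by a unit factor and by an element of the ideal of the
earlier terms affects neither the generated ideal nor weak regularity. The earlier terms may have
been changed in the same way already. -/
theorem weaklyRegular_congr_concat {R : Type*} [CommRing R] {rs ss : List R} {r s u : R}
    (h : Ideal.ofList rs = Ideal.ofList ss ∧ (IsWeaklyRegular R rs ↔ IsWeaklyRegular R ss))
    (hu : IsUnit u) (hrs : r - u * s ∈ Ideal.ofList rs) :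
    Ideal.ofList (rs ++ [r]) = Ideal.ofList (ss ++ [s]) ∧
      (IsWeaklyRegular R (rs ++ [r]) ↔ IsWeaklyRegular R (ss ++ [s])) := by
  obtain ⟨hI, hw⟩ := h
  constructor
  · rw [Ideal.ofList_append, Ideal.ofList_append, ← hI, Ideal.ofList_singleton,
      Ideal.ofList_singleton]
    apply le_antisymm <;> refine sup_le le_sup_left ?_ <;> rw [Ideal.span_singleton_le_iff_mem]
    · rw [← sub_add_cancel r (u * s)]
      exact add_mem (Ideal.mem_sup_left hrs)
        (Ideal.mul_mem_left _ _ (Ideal.mem_sup_right (Ideal.mem_span_singleton_self s)))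
    · rw [← Ideal.unit_mul_mem_iff_mem _ hu, ← sub_sub_cancel r (u * s)]
      exact sub_mem (Ideal.mem_sup_right (Ideal.mem_span_singleton_self r))
        (Ideal.mem_sup_left hrs)
  · rw [isWeaklyRegular_concat_iff, isWeaklyRegular_concat_iff, hw, ← hI]
    refine and_congr_right fun _ => forall_congr' fun x => ?_
    have h1 : (r - u * s) * x ∈ Ideal.ofList rs := Ideal.mul_mem_right _ _ hrs
    have h2 : r * x = (r - u * s) * x + u * (s * x) := by ring
    rw [h2, Ideal.add_mem_iff_right _ h1, Ideal.unit_mul_mem_iff_mem _ hu]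

/-! ### The triangular sequence -/

/-- The sequence is `h₁(x₀,x₁,x₂,x₃), h₂(x₁,x₂,x₃), h₃(x₂,x₃), x₃ⁿ`. -/
theorem isWeaklyRegular_triangular (R : Type*) [CommRing R] [Nontrivial R] (n : ℕ) :
    IsWeaklyRegular (MvPolynomial (Fin 4) R)
      [(X 0 + X 1 + X 2 + X 3 : MvPolynomial (Fin 4) R),
        X 1 ^ 2 + X 2 ^ 2 + X 3 ^ 2 + X 1 * X 2 + X 1 * X 3 + X 2 * X 3,
        X 2 ^ 3 + X 2 ^ 2 * X 3 + X 2 * X 3 ^ 2 + X 3 ^ 3,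
        X 3 ^ n] := by
  have s1 {m : ℕ} : finSuccEquiv R (m + 1) (X 1) = Polynomial.C (X 0) :=
    finSuccEquiv_X_succ (j := 0)
  have s2 {m : ℕ} : finSuccEquiv R (m + 2) (X 2) = Polynomial.C (X 1) := by
    rw [← finSuccEquiv_X_succ, Fin.succ_one_eq_two]
  have s3 : finSuccEquiv R 3 (X 3) = Polynomial.C (X 2) :=
    finSuccEquiv_X_succ (j := 2)
  have h1 := MvPolynomial.isWeaklyRegular_cons_of_monic (R := R) (m := 0) (f := X 0 ^ n)
    (by simp only [map_pow, finSuccEquiv_X_zero]; exact Polynomial.monic_X_pow n)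
    (IsWeaklyRegular.nil (MvPolynomial (Fin 0) R) (MvPolynomial (Fin 0) R))
  have h2 := MvPolynomial.isWeaklyRegular_cons_of_monic (R := R) (m := 1)
    (f := X 0 ^ 3 + X 0 ^ 2 * X 1 + X 0 * X 1 ^ 2 + X 1 ^ 3)
    (by
      simp only [map_add, map_mul, map_pow, finSuccEquiv_X_zero, s1]
      simp only [← map_pow]
      monicity!) h1
  have h3 := MvPolynomial.isWeaklyRegular_cons_of_monic (R := R) (m := 2)
    (f := X 0 ^ 2 + X 1 ^ 2 + X 2 ^ 2 + X 0 * X 1 + X 0 * X 2 + X 1 * X 2)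
    (by
      simp only [map_add, map_mul, map_pow, finSuccEquiv_X_zero, s1, s2]
      simp only [← map_pow, ← map_mul]
      monicity!) h2
  have h4 := MvPolynomial.isWeaklyRegular_cons_of_monic (R := R) (m := 3)
    (f := X 0 + X 1 + X 2 + X 3)
    (by
      simp only [map_add, finSuccEquiv_X_zero, s1, s2, s3]
      monicity!) h3
  simpa using h4

/-! ### Power sums in four variables -/

theorem esymm_four (R : Type*) [CommRing R] :
    esymm (Fin 4) R 4 = X 0 * X 1 * X 2 * X 3 := by
  have h : Finset.powersetCard 4 (Finset.univ : Finset (Fin 4)) = {Finset.univ} :=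
    Finset.powersetCard_self Finset.univ
  rw [esymm, h, Finset.sum_singleton, Fin.prod_univ_four]

/-- This is `xᵢ⁴ - e₁xᵢ³ + e₂xᵢ² - e₃xᵢ + e₄ = 0`, multiplied by `6` and with `e₁, e₂, e₃` written
in terms of the power sums by Newton's identities. -/
theorem six_mul_X_pow_four_add_esymm (R : Type*) [CommRing R] (i : Fin 4) :
    6 * (X i ^ 4 + esymm (Fin 4) R 4) =
      (6 * X i ^ 3 - 3 * psum (Fin 4) R 1 * X i ^ 2 + psum (Fin 4) R 1 ^ 2 * X i
        - 3 * psum (Fin 4) R 2 * X i) * psum (Fin 4) R 1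
      + 3 * X i ^ 2 * psum (Fin 4) R 2 + 2 * X i * psum (Fin 4) R 3 := by
  simp only [esymm_four, psum, Fin.sum_univ_four]
  fin_cases i <;> simp only [Fin.zero_eta, Fin.mk_one, Fin.reduceFinMk] <;> ring

theorem MvPolynomial.isUnit_natCast {σ K : Type*} [Field K] [CharZero K] {m : ℕ} (hm : m ≠ 0) :
    IsUnit (m : MvPolynomial σ K) := by
  rw [← map_natCast (C : K →+* MvPolynomial σ K)]
  exact (IsUnit.mk0 _ (Nat.cast_ne_zero.mpr hm)).map C

theorem MvPolynomial.map_psum_eq_sum {σ R A : Type*} [Fintype σ] [CommRing R] [CommRing A]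
    (f : MvPolynomial σ R →+* A) (n : ℕ) : f (psum σ R n) = ∑ i, f (X i) ^ n := by
  simp only [psum, map_sum, map_pow]

section PowerSumQuotient

variable (K : Type*) [Field K]

/-- All the power sums involved lie in the kernel of the constant coefficient map. -/
theorem ofList_psum_ne_top {n : ℕ} (hn : 0 < n) :
    Ideal.ofList [psum (Fin 4) K 1, psum (Fin 4) K 2, psum (Fin 4) K 3, psum (Fin 4) K n] ≠ ⊤ := by
  have h {m : ℕ} (hm : 0 < m) : psum (Fin 4) K m ∈ RingHom.ker (constantCoeff (R := K)) := by
    simp [RingHom.mem_ker, psum, hm.ne']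
  refine ne_top_of_le_ne_top (RingHom.ker_ne_top (constantCoeff (σ := Fin 4) (R := K))) ?_
  rw [Ideal.span_le]
  intro x hx
  simp only [List.mem_cons, List.not_mem_nil, or_false, Set.mem_ofPred_eq] at hx
  rcases hx with rfl | rfl | rfl | rfl
  exacts [h one_pos, h two_pos, h three_pos, h hn]

/-- The ideal `(p₁, p₂, p₃)`. -/
local notation "powerSumIdeal" =>
  (Ideal.span {psum (Fin 4) K 1, psum (Fin 4) K 2, psum (Fin 4) K 3} :
    Ideal (MvPolynomial (Fin 4) K))

theorem ofList_psum_eq :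
    Ideal.ofList [psum (Fin 4) K 1, psum (Fin 4) K 2, psum (Fin 4) K 3] = powerSumIdeal := by
  simp only [Ideal.ofList_cons, Ideal.ofList_nil, Ideal.span_insert, sup_bot_eq]

variable [CharZero K]

theorem mk_X_pow_four (i : Fin 4) :
    Ideal.Quotient.mk powerSumIdeal (X i) ^ 4 =
      -Ideal.Quotient.mk powerSumIdeal (esymm (Fin 4) K 4) := by
  rw [← map_pow, eq_neg_iff_add_eq_zero, ← map_add, Ideal.Quotient.eq_zero_iff_mem,
    ← Ideal.unit_mul_mem_iff_mem _ (MvPolynomial.isUnit_natCast (m := 6) (by norm_num)),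
    Nat.cast_ofNat, six_mul_X_pow_four_add_esymm]
  refine add_mem (add_mem ?_ ?_) ?_ <;>
    exact Ideal.mul_mem_left _ _ (Ideal.subset_span (by simp))

theorem mk_psum_four_mul_add (q r : ℕ) :
    Ideal.Quotient.mk powerSumIdeal (psum (Fin 4) K (4 * q + r)) =
      (-Ideal.Quotient.mk powerSumIdeal (esymm (Fin 4) K 4)) ^ q *
        Ideal.Quotient.mk powerSumIdeal (psum (Fin 4) K r) := by
  simp only [map_psum_eq_sum, pow_add, pow_mul, mk_X_pow_four, Finset.mul_sum]

theorem psum_four_mul_smodEq (k : ℕ) :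
    psum (Fin 4) K (4 * k) ≡ (-1) ^ k * (4 * esymm (Fin 4) K 4 ^ k) [SMOD powerSumIdeal] := by
  have h := mk_psum_four_mul_add K k 0
  have h0 : psum (Fin 4) K 0 = 4 := by simp [psum]
  rw [SModEq.def, Ideal.Quotient.mk_eq_mk, Ideal.Quotient.mk_eq_mk]
  rw [add_zero, h0] at h
  rw [h, neg_pow]
  simp only [map_mul, map_pow, map_neg, map_one]
  ring

theorem psum_mem_of_not_four_dvd {n : ℕ} (hn : ¬ 4 ∣ n) : psum (Fin 4) K n ∈ powerSumIdeal := by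
  have h := mk_psum_four_mul_add K (n / 4) (n % 4)
  rw [Nat.div_add_mod] at h
  have hr : psum (Fin 4) K (n % 4) ∈ powerSumIdeal := by
    have h4 : n % 4 = 1 ∨ n % 4 = 2 ∨ n % 4 = 3 := by omega
    rcases h4 with h4 | h4 | h4 <;> rw [h4] <;> exact Ideal.subset_span (by simp)
  rw [← Ideal.Quotient.eq_zero_iff_mem, h, Ideal.Quotient.eq_zero_iff_mem.mpr hr, mul_zero]

theorem isWeaklyRegular_psum (k : ℕ) :
    IsWeaklyRegular (MvPolynomial (Fin 4) K)
      [psum (Fin 4) K 1, psum (Fin 4) K 2, psum (Fin 4) K 3, psum (Fin 4) K (4 * k)] := by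
  have h1 := weaklyRegular_congr_concat (rs := []) (ss := []) (r := psum (Fin 4) K 1)
    (s := X 0 + X 1 + X 2 + X 3) ⟨rfl, Iff.rfl⟩ isUnit_one
    (by simp [psum, Fin.sum_univ_four])
  have h2 := weaklyRegular_congr_concat (r := psum (Fin 4) K 2)
    (s := X 1 ^ 2 + X 2 ^ 2 + X 3 ^ 2 + X 1 * X 2 + X 1 * X 3 + X 2 * X 3)
    h1 (MvPolynomial.isUnit_natCast (m := 2) (by norm_num)) (by
      rw [h1.1, List.nil_append, Ideal.ofList_singleton, Ideal.mem_span_singleton']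
      refine ⟨X 0 - (X 1 + X 2 + X 3), ?_⟩
      simp only [psum, Fin.sum_univ_four]
      push_cast
      ring)
  have h3 := weaklyRegular_congr_concat (r := psum (Fin 4) K 3)
    (s := X 2 ^ 3 + X 2 ^ 2 * X 3 + X 2 * X 3 ^ 2 + X 3 ^ 3)
    h2 (MvPolynomial.isUnit_natCast (m := 3) (by norm_num)) (by
      rw [h2.1, List.nil_append, Ideal.ofList_append, Ideal.ofList_singleton,
        Ideal.ofList_singleton, ← Ideal.span_insert, Ideal.mem_span_pair]
      -- `x₀³ + t³` is divisible by `x₀ + t` for `t = x₁ + x₂ + x₃`; what remains is divided by the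
      -- quadratic generator, which is monic in `x₁`.
      refine ⟨X 0 ^ 2 - X 0 * (X 1 + X 2 + X 3) + (X 1 + X 2 + X 3) ^ 2,
        -3 * (X 2 + X 3), ?_⟩
      simp only [psum, Fin.sum_univ_four]
      push_cast
      ring)
  have h4 := weaklyRegular_congr_concat (r := psum (Fin 4) K (4 * k)) (s := X 3 ^ (4 * k))
    h3 (MvPolynomial.isUnit_natCast (m := 4) (by norm_num)) (by
      rw [List.nil_append, List.cons_append, List.cons_append, List.nil_append, List.cons_append,
        List.nil_append, ofList_psum_eq, ← Ideal.Quotient.eq_zero_iff_mem]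
      simp only [map_sub, map_mul, map_psum_eq_sum, map_pow, pow_mul, mk_X_pow_four, map_natCast,
        Finset.sum_const, Finset.card_univ, Fintype.card_fin, nsmul_eq_mul, sub_self])
  exact h4.2.mpr (isWeaklyRegular_triangular K (4 * k))

theorem isRegular_psum_iff {n : ℕ} (hn : 0 < n) :
    IsRegular (MvPolynomial (Fin 4) K)
      [psum (Fin 4) K 1, psum (Fin 4) K 2, psum (Fin 4) K 3, psum (Fin 4) K n] ↔ 4 ∣ n := by
  constructor
  · intro h
    by_contra h4
    have hmem := psum_mem_of_not_four_dvd K h4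
    rw [← ofList_psum_eq] at hmem
    -- The zero element of the quotient can only be a nonzerodivisor if the quotient is trivial.
    have h1 := ((isWeaklyRegular_concat_iff
      [psum (Fin 4) K 1, psum (Fin 4) K 2, psum (Fin 4) K 3] _).mp h.toIsWeaklyRegular).2 1
      (by rwa [mul_one])
    refine ofList_psum_ne_top K hn ((Ideal.eq_top_iff_one _).mpr (Ideal.span_mono ?_ h1))
    exact fun x hx => List.mem_append_left [psum (Fin 4) K n] hx
  · rintro ⟨k, rfl⟩
    refine ⟨isWeaklyRegular_psum K k, ?_⟩
    rw [smul_eq_mul, Ideal.mul_top]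
    exact (ofList_psum_ne_top K hn).symm

end PowerSumQuotient

theorem mainTheorem9 (n : ℕ) (hn : 0 < n) :
    (∀ k : ℕ, n = 4 * k →
      MvPolynomial.psum (Fin 4) ℂ n ≡ (-1) ^ k * (4 * MvPolynomial.esymm (Fin 4) ℂ 4 ^ k)
        [SMOD (Ideal.span {MvPolynomial.psum (Fin 4) ℂ 1, MvPolynomial.psum (Fin 4) ℂ 2,
          MvPolynomial.psum (Fin 4) ℂ 3} : Ideal (MvPolynomial (Fin 4) ℂ))]) ∧
    (¬ 4 ∣ n →
      MvPolynomial.psum (Fin 4) ℂ n ≡ 0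
        [SMOD (Ideal.span {MvPolynomial.psum (Fin 4) ℂ 1, MvPolynomial.psum (Fin 4) ℂ 2,
          MvPolynomial.psum (Fin 4) ℂ 3} : Ideal (MvPolynomial (Fin 4) ℂ))]) ∧
    (RingTheory.Sequence.IsRegular (MvPolynomial (Fin 4) ℂ)
        [MvPolynomial.psum (Fin 4) ℂ 1, MvPolynomial.psum (Fin 4) ℂ 2,
          MvPolynomial.psum (Fin 4) ℂ 3, MvPolynomial.psum (Fin 4) ℂ n] ↔ 4 ∣ n) := by
  refine ⟨?_, fun h => SModEq.zero.mpr (psum_mem_of_not_four_dvd ℂ h), isRegular_psum_iff ℂ hn⟩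
  rintro k rfl
  exact psum_four_mul_smodEq ℂ k
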